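/- Let $A$ be a commutative ring and let $I\subseteq A$ be an ideal generated by a regular sequence $x_1,\dots,x_n$, meaning that $x_i$ is a non-zero-divisor on $A/(x_1,\dots,x_{i-1})$ for every $1\le i\le n$ (the condition $A/I\neq 0$ is not required). Let $L_0^I$ be the zeroth left derived functor of the $I$-adic completion functor $C^I(M)=\lim_s M/I^sM$ on $A$-modules, and let $\eta\colon M\to L_0^I M$ be the natural homomorphism, induced on $H_0$ by the map $P\to C^I(P)$ for a projective resolution $P$ of $M$. An $A$-module $M$ is called $L$-complete (with respect to $I$) if $\eta$ is an isomorphism. Then, for every $A$-module $M$, $$M\text{ is }L\text{-complete}\iff \operatorname{Ext}^q_A\bigl(x_i^{-1}A/(x_1,\dots,x_{i-1}),M\bigr)=0\ \text{ for all }1\le i\le n\text{ and all }q\ge 0,$$ where $x_i^{-1}A/(x_1,\dots,x_{i-1})$ denotes the localization of the $A$-module $A/(x_1,\dots,x_{i-1})$ at the powers of $x_i$. -/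

import Mathlib

open CategoryTheory

universe u

noncomputable section

variable {A : Type u} [CommRing A]

theorem adicCompletion_map_add (I : Ideal A) {M N : Type u} [AddCommGroup M] [Module A M]
    [AddCommGroup N] [Module A N] (f g : M →ₗ[A] N) :
    (AdicCompletion.map I (f + g)).restrictScalars A =
      (AdicCompletion.map I f).restrictScalars A + (AdicCompletion.map I g).restrictScalars A := by
  ext a n
  simp

/-- The `I`-adic completion functor `C^I(M) = lim_s M / I^s M` on `A`-modules. -/
def adicCompletionFunctor (I : Ideal A) : ModuleCat.{u} A ⥤ ModuleCat.{u} A where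
  obj M := ModuleCat.of A (AdicCompletion I M)
  map f := ModuleCat.ofHom ((AdicCompletion.map I f.hom).restrictScalars A)
  map_id M := by
    ext x n
    simp
  map_comp f g := by
    ext x n
    simp

instance adicCompletionFunctor_additive (I : Ideal A) :
    (adicCompletionFunctor I).Additive where
  map_add {_ _ f g} := ModuleCat.hom_ext (adicCompletion_map_add I f.hom g.hom)

/-- The natural map `M → C^I(M)`. -/
def toAdicCompletion (I : Ideal A) : 𝟭 (ModuleCat.{u} A) ⟶ adicCompletionFunctor I where
  app M := ModuleCat.ofHom (AdicCompletion.of I M)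
  naturality {M N} f := by
    refine ModuleCat.hom_ext (LinearMap.ext fun x => AdicCompletion.ext fun n => ?_)
    rfl

/-- `L_s^I`, the `s`-th left derived functor of `I`-adic completion. -/
abbrev derivedCompletion (I : Ideal A) (s : ℕ) : ModuleCat.{u} A ⥤ ModuleCat.{u} A :=
  (adicCompletionFunctor I).leftDerived s

/-- The natural map `η : M → L_0^I M`: for a projective resolution `P` of `M` it is the map
`M ≅ H_0(P) → H_0(C^I(P))` induced by `P → C^I(P)`. -/
def toDerivedCompletion (I : Ideal A) : 𝟭 (ModuleCat.{u} A) ⟶ derivedCompletion I 0 :=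
  (𝟭 (ModuleCat.{u} A)).leftDerivedZeroIsoSelf.inv ≫ NatTrans.leftDerived (toAdicCompletion I) 0

/-- `M` is `L`-complete with respect to `I` if `η : M → L_0^I M` is an isomorphism. -/
def IsLComplete (I : Ideal A) (M : Type u) [AddCommGroup M] [Module A M] : Prop :=
  IsIso ((toDerivedCompletion I).app (ModuleCat.of A M))

/-- The `A`-module `x_i⁻¹ A / (x_1, …, x_{i-1})`, that is, `A / (x_1, …, x_{i-1})` localized at the
powers of `x_i`. The entries of the list are indexed from `0`. -/
abbrev localizedQuotient (xs : List A) (i : Fin xs.length) : Type u :=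
  LocalizedModule (Submonoid.powers xs[i]) (A ⧸ Ideal.ofList (xs.take i))

end

-- Both conditions say that `M` is derived complete along every `x` in `xs`, i.e. that `telescope x
-- M` is bijective.
--
-- On the Ext side, `A[1/z]` has a free resolution of length one with relations `e_k = z e_{k+1}`,
-- and applying `Hom(-, M)` to it gives the telescope. If `M` is derived complete along `y`, so is
-- every `Ext^q(-, M)`, and a derived complete module on which `y` is surjective is zero. By the
-- long exact sequence, dividing the source by a regular `y` does not affect vanishing. The
-- quotients by `x_1, …, x_{i-1}` are thus removed by induction on `i`.
--
-- On the completion side, `L_0 M` is the cokernel of `C(P₁) → C(P₀)`. Adic completions are derived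
-- complete and the property passes to kernels and cokernels, so `L`-complete modules have it.
-- Conversely, if `M` is derived complete, so are the kernel and cokernel of `η`, and derived
-- Nakayama reduces the claim to showing that each equals `I` times itself. For the cokernel this
-- holds because `P₀` generates `C(P₀)` modulo `I`. For the kernel it is a `Tor₁` statement: `xs`
-- stays weakly regular on `C(P₀)`.

universe v

noncomputable section

open scoped Pointwise

variable {A : Type u} [CommRing A]

/-! ### Derived completeness along one element -/

/-- The endomorphism `m ↦ (k ↦ m k - x • m (k + 1))` of `∏_ℕ M`, which computes
`RHom(A[1/x], M)`. -/
def telescope (x : A) (M : Type*) [AddCommGroup M] [Module A M] : (ℕ → M) →ₗ[A] (ℕ → M) where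
  toFun m k := m k - x • m (k + 1)
  map_add' m n := by ext k; simp only [Pi.add_apply, smul_add]; abel
  map_smul' r m := by
    ext k; simp only [Pi.smul_apply, RingHom.id_apply, smul_sub, smul_comm x r]

@[simp] theorem telescope_apply (x : A) {M : Type*} [AddCommGroup M] [Module A M] (m : ℕ → M)
    (k : ℕ) : telescope x M m k = m k - x • m (k + 1) := rfl

/-- `M` is derived complete along `x`: both `Hom(A[1/x], M)` and `Ext¹(A[1/x], M)` vanish. -/
def IsDerivedComplete (x : A) (M : Type*) [AddCommGroup M] [Module A M] : Prop :=
  Function.Bijective (telescope x M)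

theorem telescope_comp {x : A} {M N : Type*} [AddCommGroup M] [Module A M] [AddCommGroup N]
    [Module A N] (f : M →ₗ[A] N) (m : ℕ → M) :
    telescope x N (f ∘ m) = f ∘ telescope x M m := by
  ext k; simp

namespace IsDerivedComplete

variable {x : A} {K M N L : Type*} [AddCommGroup K] [Module A K] [AddCommGroup M] [Module A M]
  [AddCommGroup N] [Module A N] [AddCommGroup L] [Module A L]

theorem eq_zero (h : IsDerivedComplete x M) {m : ℕ → M} (hm : telescope x M m = 0) : m = 0 :=
  h.1 (by rw [hm, map_zero])

/-- No injectivity of `f` is needed: on its image the telescope is injective as on a submodule of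
`N` and surjective as on a quotient of `M`. -/
theorem of_exact_surjective {f : M →ₗ[A] N} {g : N →ₗ[A] L} (hfg : Function.Exact f g)
    (hg : Function.Surjective g) (hM : IsDerivedComplete x M) (hN : IsDerivedComplete x N) :
    IsDerivedComplete x L := by
  constructor
  · rw [injective_iff_map_eq_zero]
    intro l hl
    obtain ⟨n, rfl⟩ := hg.comp_left l
    rw [telescope_comp] at hl
    choose m hm using fun k => (hfg _).1 (congrFun hl k)
    obtain ⟨m, rfl⟩ := hM.2 m
    have : telescope x N (n - f ∘ m) = 0 := by
      rw [map_sub, telescope_comp, sub_eq_zero]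
      exact (funext hm).symm
    rw [sub_eq_zero.1 (hN.eq_zero this)]
    ext k
    exact hfg.apply_apply_eq_zero _
  · intro l
    obtain ⟨n, rfl⟩ := hg.comp_left l
    obtain ⟨n, rfl⟩ := hN.2 n
    exact ⟨g ∘ n, telescope_comp _ _⟩

theorem of_injective_exact {f : K →ₗ[A] M} {g : M →ₗ[A] N} (hf : Function.Injective f)
    (hfg : Function.Exact f g) (hM : IsDerivedComplete x M) (hN : IsDerivedComplete x N) :
    IsDerivedComplete x K := by
  constructor
  · intro a b hab
    refine hf.comp_left (hM.1 ?_)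
    simp only [telescope_comp, hab]
  · intro k
    obtain ⟨m, hm⟩ := hM.2 (f ∘ k)
    have : g ∘ m = 0 := by
      refine hN.eq_zero ?_
      rw [telescope_comp, hm]
      ext i
      exact hfg.apply_apply_eq_zero _
    choose k' hk' using fun i => (hfg _).1 (congrFun this i)
    obtain rfl : f ∘ k' = m := funext hk'
    exact ⟨k', hf.comp_left (by simpa only [telescope_comp] using hm)⟩

theorem of_equiv (e : M ≃ₗ[A] N) (hM : IsDerivedComplete x M) : IsDerivedComplete x N := by
  refine of_injective_exact (x := x) (f := e.symm.toLinearMap) (g := (0 : M →ₗ[A] PUnit))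
    e.symm.injective (fun m => by simp) hM
    ⟨Function.injective_of_subsingleton _, fun m => ⟨m, Subsingleton.elim _ _⟩⟩

theorem ker (hM : IsDerivedComplete x M) (hN : IsDerivedComplete x N) (f : M →ₗ[A] N) :
    IsDerivedComplete x (LinearMap.ker f) :=
  of_injective_exact (Submodule.subtype_injective _) (LinearMap.exact_subtype_ker_map f) hM hN

theorem quotient_range (hM : IsDerivedComplete x M) (hN : IsDerivedComplete x N)
    (f : M →ₗ[A] N) : IsDerivedComplete x (N ⧸ LinearMap.range f) :=
  of_exact_surjective (LinearMap.exact_map_mkQ_range f) (Submodule.mkQ_surjective _) hM hN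

theorem quotSMulTop (hM : IsDerivedComplete x M) (y : A) :
    IsDerivedComplete x (QuotSMulTop y M) :=
  of_exact_surjective (f := LinearMap.lsmul A M y) (fun m => by
    simp [Submodule.mem_smul_pointwise_iff_exists]) (Submodule.mkQ_surjective _) hM hM

/-- A derived complete module on which `x` acts surjectively vanishes. -/
theorem subsingleton (hM : IsDerivedComplete x M)
    (hx : Function.Surjective fun m : M => x • m) : Subsingleton M := by
  refine subsingleton_of_forall_eq 0 fun m => ?_
  choose d hd using hx
  have : telescope x M (fun k => d^[k] m) = 0 := by
    ext k
    rw [telescope_apply, Function.iterate_succ_apply']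
    exact sub_eq_zero.2 (hd _).symm
  exact congrFun (hM.eq_zero this) 0

theorem linearMap (hM : IsDerivedComplete x M) (N : Type*) [AddCommGroup N] [Module A N] :
    IsDerivedComplete x (N →ₗ[A] M) := by
  constructor
  · rw [injective_iff_map_eq_zero]
    intro f hf
    ext k n
    have : telescope x M (fun k => f k n) = 0 := by
      ext k
      exact LinearMap.congr_fun (congrFun hf k) n
    exact congrFun (hM.eq_zero this) k
  · intro f
    let e := LinearEquiv.ofBijective _ hM
    refine ⟨fun k => LinearMap.proj k ∘ₗ e.symm.toLinearMap ∘ₗ LinearMap.pi f, ?_⟩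
    ext k n
    exact congrFun (e.apply_symm_apply (fun k => f k n)) k

/-- Since `x ^ n` kills the quotient by `I ^ n`, a solution of the homogeneous equation is divisible
to death, and the geometric series `∑ x ^ i • a (k + i)` inverts the telescope. -/
theorem adicCompletion {I : Ideal A} (hx : x ∈ I) (M : Type*) [AddCommGroup M] [Module A M] :
    IsDerivedComplete x (AdicCompletion I M) := by
  have key : ∀ (n : ℕ) (m : M ⧸ (I ^ n • ⊤ : Submodule A M)), x ^ n • m = 0 := by
    intro n m
    obtain ⟨m, rfl⟩ := Submodule.mkQ_surjective _ m
    rw [← map_smul, Submodule.mkQ_apply, Submodule.Quotient.mk_eq_zero]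
    exact Submodule.smul_mem_smul (Ideal.pow_mem_pow hx n) trivial
  have key' : ∀ (n i : ℕ) (m : M ⧸ (I ^ n • ⊤ : Submodule A M)), n ≤ i → x ^ i • m = 0 := by
    intro n i m h
    rw [← Nat.sub_add_cancel h, pow_add, mul_smul, key, smul_zero]
  constructor
  · rw [injective_iff_map_eq_zero]
    intro a ha
    have step : ∀ k, a k = x • a (k + 1) := fun k => sub_eq_zero.1 (congrFun ha k)
    have iter : ∀ n k, a k = x ^ n • a (k + n) := by
      intro n
      induction n with
      | zero => simp
      | succ n ih => intro k; rw [ih k, step, ← mul_smul, pow_succ, add_assoc]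
    ext k n
    rw [iter n k, AdicCompletion.val_smul_apply, key]
    rfl
  · intro a
    let b (k : ℕ) : AdicCompletion I M :=
      { val n := ∑ i ∈ Finset.range n, x ^ i • (a (k + i)).val n
        property := by
          intro m n h
          rw [map_sum]
          simp only [map_smul, AdicCompletion.transitionMap_comp_eval_apply]
          refine (Finset.sum_subset (Finset.range_subset_range.2 h) fun i _ hi => ?_).symm
          exact key' m _ _ (by simpa using hi) }
    refine ⟨b, ?_⟩
    ext k n
    -- The extra term `i = n` vanishes modulo `I ^ n`; it makes the sum match the shifted one in `b
    -- (k + 1)`.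
    have hs : (b k).val n = ∑ i ∈ Finset.range (n + 1), x ^ i • (a (k + i)).val n := by
      rw [Finset.sum_range_succ, key, add_zero]
    rw [telescope_apply, AdicCompletion.val_sub_apply, AdicCompletion.val_smul_apply, hs,
      Finset.sum_range_succ']
    change _ - x • ∑ i ∈ Finset.range n, x ^ i • (a (k + 1 + i)).val n = _
    simp [Finset.smul_sum, pow_succ', mul_smul, add_assoc, add_comm 1]

/-- Derived Nakayama lemma. -/
theorem subsingleton_of_ofList_smul_top (xs : List A) {M : Type v} [AddCommGroup M] [Module A M]
    (hM : ∀ y ∈ xs, IsDerivedComplete y M)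
    (h : (Ideal.ofList xs • ⊤ : Submodule A M) = ⊤) : Subsingleton M := by
  induction xs generalizing M with
  | nil =>
    rw [Ideal.ofList_nil, Submodule.bot_smul] at h
    exact (Submodule.subsingleton_iff A).1 (subsingleton_of_bot_eq_top h)
  | cons y ys ih =>
    -- By induction `M/yM = 0`, so `y` acts surjectively on `M`.
    have hq : Subsingleton (QuotSMulTop y M) := by
      refine ih (fun z hz => (hM z (List.mem_cons_of_mem _ hz)).quotSMulTop y) ?_
      exact ((Submodule.top_eq_ofList_cons_smul_iff _ _).1 h.symm).symm
    refine (hM y List.mem_cons_self).subsingleton fun m => ?_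
    have : m ∈ y • (⊤ : Submodule A M) := by
      rw [Submodule.Quotient.subsingleton_iff.1 hq]; trivial
    obtain ⟨m', -, h'⟩ := (Submodule.mem_smul_pointwise_iff_exists _ _ _).1 this
    exact ⟨m', h'⟩

end IsDerivedComplete

/-! ### Weakly regular sequences and powers -/

namespace RingTheory.Sequence.IsWeaklyRegular

/-- Reduction modulo `r` keeps the sequence exact on the left because `r` is regular on `M₃`, so
induction applies. -/
theorem of_short_exact {M₁ M₂ M₃ : Type*} [AddCommGroup M₁] [Module A M₁] [AddCommGroup M₂]
    [Module A M₂] [AddCommGroup M₃] [Module A M₃] {f : M₁ →ₗ[A] M₂} {g : M₂ →ₗ[A] M₃} {rs : List A}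
    (hf : Function.Injective f) (hfg : Function.Exact f g) (hg : Function.Surjective g)
    (h₁ : IsWeaklyRegular M₁ rs) (h₃ : IsWeaklyRegular M₃ rs) : IsWeaklyRegular M₂ rs := by
  induction rs generalizing M₁ M₂ M₃ with
  | nil => exact .nil _ _
  | cons r rs ih =>
    rw [isWeaklyRegular_cons_iff] at h₁ h₃ ⊢
    refine ⟨isSMulRegular_of_range_eq_ker hf hfg.linearMap_ker_eq.symm h₁.1 h₃.1, ?_⟩
    refine ih (f := QuotSMulTop.map r f) (g := QuotSMulTop.map r g) ?_
      (QuotSMulTop.map_exact r hfg hg) (QuotSMulTop.map_surjective r hg) h₁.2 h₃.2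
    have h := QuotSMulTop.map_first_exact_on_four_term_exact_of_isSMulRegular_last
      (f₁ := (0 : M₁ →ₗ[A] M₁)) ((LinearMap.exact_zero_iff_injective _ f).2 hf) hfg h₃.1
    rw [map_zero] at h
    exact (LinearMap.exact_zero_iff_injective _ _).1 h

theorem pow_succ_cons {M : Type*} [AddCommGroup M] [Module A M] {y : A} {zs : List A}
    (h : IsWeaklyRegular M (y :: zs)) (k : ℕ) : IsWeaklyRegular M (y ^ (k + 1) :: zs) := by
  rw [isWeaklyRegular_cons_iff] at h ⊢
  refine ⟨h.1.pow _, ?_⟩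
  induction k with
  | zero =>
    rw [zero_add, pow_one]
    exact h.2
  | succ k ih =>
    have h₁ : y ^ (k + 1) • (⊤ : Submodule A M) ≤
        (y ^ (k + 1 + 1) • (⊤ : Submodule A M)).comap (LinearMap.lsmul A M y) := by
      intro m hm
      obtain ⟨n, -, rfl⟩ := (Submodule.mem_smul_pointwise_iff_exists _ _ _).1 hm
      exact (Submodule.mem_smul_pointwise_iff_exists _ _ _).2 ⟨n, trivial, by
        rw [LinearMap.lsmul_apply, ← mul_smul, pow_succ' y (k + 1)]⟩
    have h₂ : y ^ (k + 1 + 1) • (⊤ : Submodule A M) ≤ y • (⊤ : Submodule A M) := by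
      intro m hm
      obtain ⟨n, -, rfl⟩ := (Submodule.mem_smul_pointwise_iff_exists _ _ _).1 hm
      exact (Submodule.mem_smul_pointwise_iff_exists _ _ _).2 ⟨y ^ (k + 1) • n, trivial, by
        rw [← mul_smul, pow_succ' y (k + 1)]⟩
    -- The sequence `0 → M/y^(k+1) → M/y^(k+2) → M/y → 0`, whose first map is multiplication by `y`.
    refine of_short_exact (f := Submodule.mapQ _ _ _ h₁) (g := Submodule.factor h₂) ?_ ?_
      (Submodule.factor_surjective h₂) ih h.2
    · rw [injective_iff_map_eq_zero]
      intro m hm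
      obtain ⟨m, rfl⟩ := Submodule.mkQ_surjective _ m
      rw [Submodule.mkQ_apply, Submodule.mapQ_apply, Submodule.Quotient.mk_eq_zero,
        Submodule.mem_smul_pointwise_iff_exists] at hm
      obtain ⟨n, -, hn⟩ := hm
      rw [Submodule.mkQ_apply, Submodule.Quotient.mk_eq_zero,
        Submodule.mem_smul_pointwise_iff_exists]
      refine ⟨n, trivial, h.1 ?_⟩
      change y • y ^ (k + 1) • n = y • m
      rw [← mul_smul, ← pow_succ']
      exact hn
    · intro m
      obtain ⟨m, rfl⟩ := Submodule.mkQ_surjective _ m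
      rw [Submodule.factor_mk, Submodule.mkQ_apply, Submodule.mkQ_apply,
        Submodule.Quotient.mk_eq_zero, Submodule.mem_smul_pointwise_iff_exists]
      constructor
      · rintro ⟨n, -, rfl⟩
        exact ⟨Submodule.Quotient.mk n, rfl⟩
      · rintro ⟨n, hn⟩
        obtain ⟨n, rfl⟩ := Submodule.mkQ_surjective _ n
        rw [Submodule.mkQ_apply, Submodule.mapQ_apply, eq_comm, Submodule.Quotient.eq,
          Submodule.mem_smul_pointwise_iff_exists] at hn
        obtain ⟨l, -, hl⟩ := hn
        refine ⟨n + y ^ (k + 1) • l, trivial, ?_⟩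
        rw [smul_add, ← mul_smul, ← pow_succ', hl, LinearMap.lsmul_apply]
        abel

theorem map_pow_succ {M : Type*} [AddCommGroup M] [Module A M] {rs : List A}
    (h : IsWeaklyRegular M rs) (k : ℕ) : IsWeaklyRegular M (rs.map (· ^ (k + 1))) := by
  induction rs generalizing M with
  | nil => exact .nil _ _
  | cons r rs ih =>
    have h' := h.pow_succ_cons k
    rw [isWeaklyRegular_cons_iff] at h'
    exact .cons h'.1 (ih h'.2)

/-- Moving `x` past `y` is harmless for `x`: if `x p = y q`, then `q = x r` by regularity of `y`
modulo `x`, hence `p = y r`. No claim is made about `y` on `M` itself. -/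
theorem isSMulRegular_quotient_tail {M : Type*} [AddCommGroup M] [Module A M] {x : A}
    {ys : List A} (h : IsWeaklyRegular M (x :: ys)) :
    IsSMulRegular (M ⧸ (Ideal.ofList ys • ⊤ : Submodule A M)) x := by
  induction ys generalizing M with
  | nil =>
    rw [isWeaklyRegular_cons_iff] at h
    refine (LinearEquiv.isSMulRegular_congr
      (Submodule.quotEquivOfEqBot _ ?_) x).2 h.1
    rw [Ideal.ofList_nil, Submodule.bot_smul]
  | cons y zs ih =>
    rw [(Submodule.quotOfListConsSMulTopEquivQuotSMulTopInner M y zs).isSMulRegular_congr x]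
    apply ih
    have hz : IsWeaklyRegular (M ⧸ (Ideal.ofList [x, y] • ⊤ : Submodule A M)) zs :=
      ((isWeaklyRegular_append_iff M [x, y] zs).1 h).2
    rw [isWeaklyRegular_cons_iff, isWeaklyRegular_cons_iff] at h
    refine .cons ?_ ?_
    · rw [isSMulRegular_quotient_iff_mem_of_smul_mem]
      intro p hp
      obtain ⟨q, -, hq⟩ := (Submodule.mem_smul_pointwise_iff_exists _ _ _).1 hp
      have hq' : q ∈ x • (⊤ : Submodule A M) := by
        refine (isSMulRegular_quotient_iff_mem_of_smul_mem _ _).1 h.2.1 q ?_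
        rw [hq]
        exact Submodule.smul_mem_pointwise_smul _ _ _ trivial
      obtain ⟨r, -, rfl⟩ := (Submodule.mem_smul_pointwise_iff_exists _ _ _).1 hq'
      refine (Submodule.mem_smul_pointwise_iff_exists _ _ _).2 ⟨r, trivial, h.1 ?_⟩
      simp only [← hq, smul_comm x y]
    · have e₁ : (Ideal.ofList [x, y] • ⊤ : Submodule A M) = Ideal.ofList [y, x] • ⊤ := by
        simp [Ideal.ofList_cons, sup_comm]
      refine (LinearEquiv.isWeaklyRegular_congr (Submodule.quotEquivOfEq _ _ e₁ ≪≫ₗ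
        Submodule.quotOfListConsSMulTopEquivQuotSMulTopInner M y [x] ≪≫ₗ
        Submodule.quotEquivOfEq _ _ ?_) zs).1 hz
      rw [Ideal.ofList_singleton, Submodule.ideal_span_singleton_smul]

/-- Multiplication by the first element of a weakly regular sequence reflects the adic topology. -/
theorem exists_mem_pow_smul_top_of_smul_mem {M : Type*} [AddCommGroup M] [Module A M] {x : A}
    {ys : List A} (h : IsWeaklyRegular M (x :: ys)) (s : ℕ) :
    ∃ N, s ≤ N ∧ ∀ m : M, x • m ∈ (Ideal.ofList (x :: ys) ^ N • ⊤ : Submodule A M) →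
      m ∈ (Ideal.ofList (x :: ys) ^ s • ⊤ : Submodule A M) := by
  set J := Ideal.ofList (x :: ys) with hJ
  set J' := Ideal.ofList (ys.map (· ^ (s + 1))) with hJ'
  have mem : ∀ y ∈ x :: ys, y ∈ J := fun y hy => Ideal.subset_span hy
  -- The exponent `s + 1` leaves `x ^ s` after one factor `x` is cancelled.
  have hrad : J ≤ (Ideal.span {x ^ (s + 1)} ⊔ J').radical := by
    refine Ideal.span_le.2 fun y hy => ⟨s + 1, ?_⟩
    rcases List.mem_cons.1 hy with rfl | hy
    · exact Ideal.mem_sup_left (Ideal.mem_span_singleton_self _)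
    · exact Ideal.mem_sup_right (Ideal.subset_span (List.mem_map_of_mem hy))
  have hfg : J.FG := Submodule.fg_span (List.finite_toSet _)
  obtain ⟨N, hN⟩ := Ideal.exists_pow_le_of_le_radical_of_fg hrad hfg
  have hreg : IsSMulRegular (M ⧸ (J' • ⊤ : Submodule A M)) x := by
    refine isSMulRegular_quotient_tail ?_
    rw [isWeaklyRegular_cons_iff] at h ⊢
    exact ⟨h.1, h.2.map_pow_succ s⟩
  refine ⟨max s N, le_max_left _ _, fun m hm => ?_⟩
  have hm' := Submodule.smul_mono_left ((Ideal.pow_le_pow_right (le_max_right s N)).trans hN) hm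
  rw [Submodule.sup_smul, Submodule.ideal_span_singleton_smul, Submodule.mem_sup] at hm'
  obtain ⟨z, hz, r, hr, hzr⟩ := hm'
  obtain ⟨q, -, rfl⟩ := (Submodule.mem_smul_pointwise_iff_exists _ _ _).1 hz
  have hmem : m - x ^ s • q ∈ (J' • ⊤ : Submodule A M) := by
    refine (isSMulRegular_quotient_iff_mem_of_smul_mem _ _).1 hreg _ ?_
    rw [smul_sub, ← mul_smul, ← pow_succ', ← hzr, add_sub_cancel_left]
    exact hr
  have hle : J' ≤ J ^ s := by
    refine Ideal.span_le.2 fun y hy => ?_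
    obtain ⟨z, hz, rfl⟩ := List.mem_map.1 hy
    exact Ideal.pow_le_pow_right (Nat.le_succ s)
      (Ideal.pow_mem_pow (mem z (List.mem_cons_of_mem _ hz)) _)
  rw [← sub_add_cancel m (x ^ s • q)]
  exact add_mem (Submodule.smul_mono_left hle hmem)
    (Submodule.smul_mem_smul (Ideal.pow_mem_pow (mem x List.mem_cons_self) _) trivial)

end RingTheory.Sequence.IsWeaklyRegular

/-! ### Adic completion and reduction modulo one element -/

namespace AdicCompletion

variable {I : Ideal A} {x : A} {M : Type*} [AddCommGroup M] [Module A M]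

theorem isSMulRegular
    (H : ∀ s, ∃ N, s ≤ N ∧ ∀ m : M, x • m ∈ (I ^ N • ⊤ : Submodule A M) →
      m ∈ (I ^ s • ⊤ : Submodule A M)) :
    IsSMulRegular (AdicCompletion I M) x := by
  rw [isSMulRegular_iff_right_eq_zero_of_smul]
  intro a ha
  ext s
  obtain ⟨N, hsN, hN⟩ := H s
  obtain ⟨m, hm⟩ := Submodule.mkQ_surjective _ (a.val N)
  have hx : x • a.val N = 0 := by rw [← val_smul_apply, ha]; rfl
  rw [← transitionMap_comp_eval_apply I M hsN, ← hm]
  rw [← hm, ← map_smul, Submodule.mkQ_apply, Submodule.Quotient.mk_eq_zero] at hx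
  exact (Submodule.Quotient.mk_eq_zero _).2 (hN m hx)

/-- An element of the kernel is `x b_n` modulo `I ^ n`, but the `b_n` need not be compatible. By `H`
the differences `b_n - b_(N s)` lie in `I ^ s M` for `n ≥ N s`, so the subsequence `b_(N s)` defines
a quotient by `x`. -/
theorem ker_map_mkQ_smul_top
    (H : ∀ s, ∃ N, s ≤ N ∧ ∀ m : M, x • m ∈ (I ^ N • ⊤ : Submodule A M) →
      m ∈ (I ^ s • ⊤ : Submodule A M)) :
    LinearMap.ker ((map I (x • (⊤ : Submodule A M)).mkQ).restrictScalars A) =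
      x • (⊤ : Submodule A (AdicCompletion I M)) := by
  apply le_antisymm
  · intro a ha
    have hb : ∀ n, ∃ b : M, a.val n = x • Submodule.Quotient.mk b := by
      intro n
      obtain ⟨p, hp⟩ := Submodule.mkQ_surjective _ (a.val n)
      have h0 : (map I (x • (⊤ : Submodule A M)).mkQ a).val n = 0 := by
        have : map I (x • (⊤ : Submodule A M)).mkQ a = 0 := ha
        rw [this]; rfl
      rw [map_val_apply, ← hp] at h0
      have h1 : (x • (⊤ : Submodule A M)).mkQ p ∈
          (I ^ n • ⊤ : Submodule A (M ⧸ x • (⊤ : Submodule A M))) :=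
        (Submodule.Quotient.mk_eq_zero _).1 h0
      rw [← (Submodule.mkQ_surjective _ |> LinearMap.range_eq_top.2 :
        LinearMap.range (x • (⊤ : Submodule A M)).mkQ = ⊤), LinearMap.range_eq_map,
        ← Submodule.map_smul''] at h1
      obtain ⟨q, hq, hqp⟩ := h1
      rw [Submodule.mkQ_apply, Submodule.mkQ_apply, eq_comm, Submodule.Quotient.eq,
        Submodule.mem_smul_pointwise_iff_exists] at hqp
      obtain ⟨b, -, hb⟩ := hqp
      refine ⟨b, ?_⟩
      rw [← hp, Submodule.mkQ_apply, ← Submodule.Quotient.mk_smul, Submodule.Quotient.eq, hb,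
        sub_sub_cancel]
      exact hq
    choose b hb using hb
    choose N hsN hN using H
    have hcauchy : ∀ s n, N s ≤ n → b n - b (N s) ∈ (I ^ s • ⊤ : Submodule A M) := by
      intro s n hn
      refine hN s _ ?_
      have := transitionMap_comp_eval_apply I M hn a
      rw [hb, hb, map_smul] at this
      rw [smul_sub]
      exact (Submodule.Quotient.eq _).1 this
    let c : AdicCompletion I M :=
      { val s := Submodule.Quotient.mk (b (N s))
        property := by
          intro s t hst
          refine (Submodule.Quotient.eq (I ^ s • ⊤ : Submodule A M)).2 ?_
          -- `N` need not be monotone, so both terms are compared with a later one.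
          rw [← sub_sub_sub_cancel_left _ _ (b (max (N s) (N t)))]
          exact sub_mem (hcauchy s _ (le_max_left _ _)) (Submodule.smul_mono_left
            (Ideal.pow_le_pow_right hst) (hcauchy t _ (le_max_right _ _))) }
    refine (Submodule.mem_smul_pointwise_iff_exists _ _ _).2 ⟨c, trivial, ?_⟩
    ext s
    have := transitionMap_comp_eval_apply I M (hsN s) a
    rw [← this, hb, map_smul, val_smul_apply]
    rfl
  · intro a ha
    obtain ⟨c, -, rfl⟩ := (Submodule.mem_smul_pointwise_iff_exists _ _ _).1 ha
    rw [LinearMap.mem_ker]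
    ext s
    obtain ⟨p, hp⟩ := Submodule.mkQ_surjective _ (c.val s)
    rw [LinearMap.restrictScalars_apply, map_val_apply, val_smul_apply, ← hp, ← map_smul]
    refine (Submodule.Quotient.mk_eq_zero _).2 ?_
    have : (x • (⊤ : Submodule A M)).mkQ (x • p) = 0 :=
      (Submodule.Quotient.mk_eq_zero _).2 (Submodule.smul_mem_pointwise_smul _ _ _ trivial)
    rw [this]
    exact zero_mem _

/-- Adic completion commutes with reduction modulo an element that reflects the topology. -/
def quotSMulTopEquiv
    (H : ∀ s, ∃ N, s ≤ N ∧ ∀ m : M, x • m ∈ (I ^ N • ⊤ : Submodule A M) →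
      m ∈ (I ^ s • ⊤ : Submodule A M)) :
    QuotSMulTop x (AdicCompletion I M) ≃ₗ[A] AdicCompletion I (QuotSMulTop x M) :=
  Submodule.quotEquivOfEq _ _ (ker_map_mkQ_smul_top H).symm ≪≫ₗ
    LinearMap.quotKerEquivOfSurjective _
      (map_surjective I (Submodule.mkQ_surjective (x • (⊤ : Submodule A M))))

end AdicCompletion

theorem Submodule.pow_smul_top_congr {M : Type*} [AddCommGroup M] [Module A M] {I J : Ideal A}
    (h : (I • ⊤ : Submodule A M) = J • ⊤) (n : ℕ) : (I ^ n • ⊤ : Submodule A M) = J ^ n • ⊤ := by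
  induction n with
  | zero => simp
  | succ n ih =>
    rw [pow_succ', mul_smul, ih, ← mul_smul, mul_comm, mul_smul, h, ← mul_smul, pow_succ]

theorem Submodule.map_mkQ_smul_top {M : Type*} [AddCommGroup M] [Module A M] (I : Ideal A)
    (N : Submodule A M) : (I • ⊤ : Submodule A M).map N.mkQ = I • ⊤ := by
  rw [Submodule.map_smul'', Submodule.map_top, Submodule.range_mkQ]

namespace RingTheory.Sequence.IsWeaklyRegular

/-- A weakly regular sequence generating the topology stays weakly regular on the completion. -/
theorem adicCompletion {M : Type*} [AddCommGroup M] [Module A M] {I : Ideal A} {xs : List A}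
    (h : IsWeaklyRegular M xs) (hI : (I • ⊤ : Submodule A M) = Ideal.ofList xs • ⊤) :
    IsWeaklyRegular (AdicCompletion I M) xs := by
  induction xs generalizing M with
  | nil => exact .nil _ _
  | cons x ys ih =>
    have H := h.exists_mem_pow_smul_top_of_smul_mem
    simp only [← Submodule.pow_smul_top_congr hI] at H
    rw [isWeaklyRegular_cons_iff] at h
    refine .cons (AdicCompletion.isSMulRegular H) ?_
    refine ((AdicCompletion.quotSMulTopEquiv H).isWeaklyRegular_congr ys).2 (ih h.2 ?_)
    -- The ideal `I` stays fixed while the list shrinks. As `x` acts by zero on `M/xM`, `I` and the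
    -- ideal of `ys` still give the same submodule there.
    rw [← Submodule.map_mkQ_smul_top I, hI, Submodule.map_mkQ_smul_top, Ideal.ofList_cons,
      Submodule.sup_smul, Submodule.ideal_span_singleton_smul, sup_eq_right]
    intro m hm
    obtain ⟨m, -, rfl⟩ := (Submodule.mem_smul_pointwise_iff_exists _ _ _).1 hm
    obtain ⟨m, rfl⟩ := Submodule.mkQ_surjective _ m
    rw [← map_smul, Submodule.mkQ_apply, (Submodule.Quotient.mk_eq_zero _).2
      (Submodule.smul_mem_pointwise_smul m x ⊤ trivial)]
    exact zero_mem _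

end RingTheory.Sequence.IsWeaklyRegular

/-! ### Vanishing of Ext out of localizations -/

theorem ModuleCat.shortExact_of_linearMap {M₁ M₂ M₃ : Type u} [AddCommGroup M₁] [Module A M₁]
    [AddCommGroup M₂] [Module A M₂] [AddCommGroup M₃] [Module A M₃] {f : M₁ →ₗ[A] M₂}
    {g : M₂ →ₗ[A] M₃} (hf : Function.Injective f) (hfg : Function.Exact f g)
    (hg : Function.Surjective g) :
    (ModuleCat.shortComplexOfCompEqZero f g hfg.linearMap_comp_eq_zero).ShortExact where
  exact := ModuleCat.shortComplex_exact _ hfg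
  mono_f := (ModuleCat.mono_iff_injective _).2 hf
  epi_g := (ModuleCat.epi_iff_surjective _).2 hg

open Abelian

section Precomp

variable {S : ShortComplex (ModuleCat.{u} A)} (hS : S.ShortExact) (Y : ModuleCat.{u} A)

include hS in
/-- If the first two terms of a short exact sequence are projective, then the groups
`Ext^q(S.X₃, Y)` are computed by the map `Hom(S.X₂, Y) → Hom(S.X₁, Y)`. -/
theorem CategoryTheory.ShortComplex.ShortExact.forall_subsingleton_ext_iff_of_projective
    [Projective S.X₁] [Projective S.X₂] :
    (∀ q, Subsingleton (Ext.{u} S.X₃ Y q)) ↔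
      Function.Bijective fun e : Ext.{u} S.X₂ Y 0 => (Ext.mk₀ S.f).comp e (zero_add 0) := by
  have := hS.epi_g
  constructor
  · intro h
    constructor
    · intro a b hab
      have h0 : (Ext.mk₀ S.f).comp (a - b) (zero_add 0) = 0 := by
        rw [sub_eq_add_neg, Ext.comp_add, Ext.comp_neg, ← sub_eq_add_neg, sub_eq_zero]
        exact hab
      obtain ⟨c, hc⟩ := Ext.contravariant_sequence_exact₂ hS Y _ h0
      have := h 0
      rw [Subsingleton.elim c 0, Ext.comp_zero] at hc
      exact sub_eq_zero.1 hc.symm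
    · intro a
      have := h 1
      exact Ext.contravariant_sequence_exact₁ hS Y a (add_zero 1) (Subsingleton.elim _ _)
  · rintro ⟨hinj, hsurj⟩ q
    refine subsingleton_of_forall_eq 0 fun e => ?_
    match q with
    | 0 =>
      apply Ext.precomp_mk₀_injective_of_epi Y S.g
      refine hinj ?_
      change (Ext.mk₀ S.f).comp ((Ext.mk₀ S.g).comp e (zero_add 0)) (zero_add 0) =
        (Ext.mk₀ S.f).comp ((Ext.mk₀ S.g).comp 0 (zero_add 0)) (zero_add 0)
      rw [Ext.mk₀_comp_mk₀_assoc, S.zero]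
      simp
    | 1 =>
      obtain ⟨c, rfl⟩ := Ext.contravariant_sequence_exact₃ hS Y e (Ext.eq_zero_of_projective _)
        (add_zero 1)
      obtain ⟨c, rfl⟩ := hsurj c
      exact hS.extClass_comp_assoc _
    | q + 2 =>
      obtain ⟨c, rfl⟩ := Ext.contravariant_sequence_exact₃ hS Y e (Ext.eq_zero_of_projective _)
        (n₀ := q + 1) (by lia)
      rw [Ext.eq_zero_of_projective c, Ext.comp_zero]

end Precomp

/-- `Ext` into a derived complete module is derived complete. -/
theorem IsDerivedComplete.ext {x : A} {M : ModuleCat.{u} A} (hM : IsDerivedComplete x M)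
    (N : ModuleCat.{u} A) (q : ℕ) : IsDerivedComplete x (Ext.{u} N M q) := by
  induction q generalizing N with
  | zero =>
    exact (hM.linearMap N).of_equiv
      ((ModuleCat.homLinearEquiv (S := A)).symm ≪≫ₗ (Ext.linearEquiv₀ (R := A)).symm)
  | succ q ih =>
    -- Dimension shifting: `Ext^(q+1)(N, M)` is a cokernel of a map between groups `Ext^q(-, M)`,
    -- complete by induction.
    let S := ShortComplex.mk (Limits.kernel.ι (Projective.π N)) (Projective.π N)
      (Limits.kernel.condition _)
    have hS : S.ShortExact :=
      { exact := ShortComplex.exact_kernel _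
        mono_f := inferInstanceAs (Mono (Limits.kernel.ι _))
        epi_g := inferInstanceAs (Epi (Projective.π N)) }
    have : Projective S.X₂ := inferInstanceAs (Projective (Projective.over N))
    refine of_exact_surjective
      (f := Ext.bilinearCompOfLinear A S.X₁ S.X₂ M 0 q q (zero_add q) (Ext.mk₀ S.f))
      (g := Ext.bilinearCompOfLinear A S.X₃ S.X₁ M 1 q (q + 1) (add_comm 1 q) hS.extClass)
      (fun e => ?_) (fun e => ?_) (ih _) (ih _)
    · refine ⟨fun he => Ext.contravariant_sequence_exact₁ hS M e (add_comm 1 q) he, ?_⟩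
      rintro ⟨e, rfl⟩
      exact hS.extClass_comp_assoc _ (h := add_comm 1 q)
    · exact Ext.contravariant_sequence_exact₃ hS M e (Ext.eq_zero_of_projective _) (add_comm 1 q)

/-- Localization of a linear equivalence, linear over the base ring. -/
def LocalizedModule.congr (s : Submonoid A) {M N : Type*} [AddCommGroup M] [Module A M]
    [AddCommGroup N] [Module A N] (e : M ≃ₗ[A] N) : LocalizedModule s M ≃ₗ[A] LocalizedModule s N :=
  .ofBijective (IsLocalizedModule.map s (mkLinearMap s M) (mkLinearMap s N) e.toLinearMap)
    ⟨IsLocalizedModule.map_injective _ _ _ _ e.injective,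
      IsLocalizedModule.map_surjective _ _ _ _ e.surjective⟩

/-- All groups `Ext^q_A(N, M)` vanish. -/
def ExtVanishes (N M : Type u) [AddCommGroup N] [Module A N] [AddCommGroup M] [Module A M] :
    Prop :=
  ∀ q : ℕ, Subsingleton (Ext.{u} (ModuleCat.of A N) (ModuleCat.of A M) q)

section ExtVanishes

variable {N N' T M : Type u} [AddCommGroup N] [Module A N] [AddCommGroup N'] [Module A N']
  [AddCommGroup T] [Module A T] [AddCommGroup M] [Module A M]

theorem ExtVanishes.of_equiv (e : N ≃ₗ[A] N') (h : ExtVanishes (A := A) N M) :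
    ExtVanishes (A := A) N' M := by
  intro q
  have := h q
  refine subsingleton_of_forall_eq 0 fun x => ?_
  have hx : x = (Ext.mk₀ e.toModuleIso.inv).comp
      ((Ext.mk₀ e.toModuleIso.hom).comp x (zero_add q)) (zero_add q) := by
    rw [Ext.mk₀_comp_mk₀_assoc, e.toModuleIso.inv_hom_id, Ext.mk₀_id_comp]
  rw [hx, Subsingleton.elim ((Ext.mk₀ e.toModuleIso.hom).comp x (zero_add q)) 0, Ext.comp_zero]

theorem extVanishes_congr (e : N ≃ₗ[A] N') :
    ExtVanishes (A := A) N M ↔ ExtVanishes (A := A) N' M :=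
  ⟨.of_equiv e, .of_equiv e.symm⟩

/-- If the groups for `T` vanish, `y` is surjective on each `Ext^q(N, M)`; this group is derived
complete along `y`, hence zero. The converse is the long exact sequence. -/
theorem extVanishes_iff_of_exact_lsmul {y : A} {g : N →ₗ[A] T} (hM : IsDerivedComplete y M)
    (hy : IsSMulRegular N y) (hfg : Function.Exact (LinearMap.lsmul A N y) g)
    (hg : Function.Surjective g) : ExtVanishes (A := A) T M ↔ ExtVanishes (A := A) N M := by
  have hS := ModuleCat.shortExact_of_linearMap (f := LinearMap.lsmul A N y) hy hfg hg
  have : Epi (ModuleCat.ofHom g) := hS.epi_g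
  constructor
  · intro h q
    have := h (q + 1)
    refine (IsDerivedComplete.ext (M := ModuleCat.of A M) hM (ModuleCat.of A N) q).subsingleton
      fun e => ?_
    obtain ⟨e', he'⟩ := Ext.contravariant_sequence_exact₁ hS (ModuleCat.of A M) e (add_comm 1 q)
      (Subsingleton.elim _ _)
    refine ⟨e', ?_⟩
    have hf : ModuleCat.ofHom (LinearMap.lsmul A N y) = y • 𝟙 (ModuleCat.of A N) := rfl
    change (Ext.mk₀ (ModuleCat.ofHom (LinearMap.lsmul A N y))).comp e' (zero_add q) = e at he'
    rw [hf, Ext.mk₀_smul, Ext.smul_comp, Ext.mk₀_id_comp] at he'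
    exact he'
  · intro h q
    refine subsingleton_of_forall_eq 0 fun e => ?_
    match q with
    | 0 =>
      have := h 0
      exact Ext.precomp_mk₀_injective_of_epi (ModuleCat.of A M) (ModuleCat.ofHom g) (Subsingleton.elim
        (α := Ext (ModuleCat.of A N) (ModuleCat.of A M) 0) _ _)
    | q + 1 =>
      have := h (q + 1)
      have := h q
      obtain ⟨c, rfl⟩ := Ext.contravariant_sequence_exact₃ hS (ModuleCat.of A M) e
        (Subsingleton.elim (α := Ext (ModuleCat.of A N) (ModuleCat.of A M) (q + 1)) _ _)
        (add_comm 1 q)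
      rw [Subsingleton.elim (α := Ext (ModuleCat.of A N) (ModuleCat.of A M) q) c 0, Ext.comp_zero]

theorem extVanishes_localizedModule_quotSMulTop_iff (s : Submonoid A) {y : A}
    (hM : IsDerivedComplete y M) (hy : IsSMulRegular N y) :
    ExtVanishes (A := A) (LocalizedModule s (QuotSMulTop y N)) M ↔
      ExtVanishes (A := A) (LocalizedModule s N) M := by
  let l := LocalizedModule.mkLinearMap s N
  let l' := LocalizedModule.mkLinearMap s (QuotSMulTop y N)
  have hl : LinearMap.lsmul A (LocalizedModule s N) y =
      IsLocalizedModule.map s l l (LinearMap.lsmul A N y) := by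
    have : LinearMap.lsmul A N y = y • LinearMap.id := rfl
    rw [this, map_smul, IsLocalizedModule.map_id]
    rfl
  refine extVanishes_iff_of_exact_lsmul
    (g := IsLocalizedModule.map s l l' (y • (⊤ : Submodule A N)).mkQ) hM ?_ ?_
    (IsLocalizedModule.map_surjective s l l' _ (Submodule.mkQ_surjective _))
  · have := IsLocalizedModule.map_injective s l l (LinearMap.lsmul A N y) hy
    rw [← hl] at this
    exact this
  · rw [hl]
    exact IsLocalizedModule.map_exact s l l l' _ _ (LinearMap.exact_lsmul_mkQ_smul_top N y)

/-- Along derived complete directions, `Ext` out of a localization is insensitive to reduction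
modulo a weakly regular sequence. -/
theorem extVanishes_localizedModule_quotient_iff (s : Submonoid A) {ys : List A}
    (hM : ∀ y ∈ ys, IsDerivedComplete y M) (hys : RingTheory.Sequence.IsWeaklyRegular N ys) :
    ExtVanishes (A := A) (LocalizedModule s (N ⧸ (Ideal.ofList ys • ⊤ : Submodule A N))) M ↔
      ExtVanishes (A := A) (LocalizedModule s N) M := by
  induction ys generalizing N with
  | nil =>
    exact extVanishes_congr (LocalizedModule.congr s (Submodule.quotEquivOfEqBot
      (Ideal.ofList [] • ⊤ : Submodule A N) (by rw [Ideal.ofList_nil, Submodule.bot_smul])))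
  | cons y ys ih =>
    rw [RingTheory.Sequence.isWeaklyRegular_cons_iff] at hys
    rw [← extVanishes_localizedModule_quotSMulTop_iff s (hM y List.mem_cons_self) hys.1,
      ← ih (fun z hz => hM z (List.mem_cons_of_mem _ hz)) hys.2]
    exact extVanishes_congr (LocalizedModule.congr s
      (Submodule.quotOfListConsSMulTopEquivQuotSMulTopInner N y ys))

section Presentation

variable (z : A)

/-- The relations `e_k = z e_{k+1}` in the presentation of `A[1/z]`. -/
def awayRelations : (ℕ →₀ A) →ₗ[A] (ℕ →₀ A) :=
  Finsupp.lsum A fun k => Finsupp.lsingle k - z • Finsupp.lsingle (k + 1)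

/-- The generators `e_k = 1/z^k` in the presentation of `A[1/z]`. -/
def awayGenerators : (ℕ →₀ A) →ₗ[A] LocalizedModule (Submonoid.powers z) A :=
  Finsupp.lsum A fun k => LinearMap.toSpanSingleton A _
    (LocalizedModule.mk 1 ⟨z ^ k, pow_mem (Submonoid.mem_powers z) k⟩)

theorem awayRelations_single (k : ℕ) (a : A) :
    awayRelations z (Finsupp.single k a) = Finsupp.single k a - Finsupp.single (k + 1) (z * a) := by
  simp [awayRelations]

theorem awayGenerators_single (k : ℕ) (a : A) :
    awayGenerators z (Finsupp.single k a) = LocalizedModule.mk a ⟨z ^ k, pow_mem (Submonoid.mem_powers z) k⟩ := by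
  simp [awayGenerators, LocalizedModule.smul'_mk]

theorem awayRelations_apply_zero (p : ℕ →₀ A) : awayRelations z p 0 = p 0 := by
  induction p using Finsupp.induction_linear with
  | zero => simp
  | add p q hp hq => simp [hp, hq]
  | single k a => simp [awayRelations_single]

theorem awayRelations_apply_succ (p : ℕ →₀ A) (k : ℕ) :
    awayRelations z p (k + 1) = p (k + 1) - z * p k := by
  induction p using Finsupp.induction_linear with
  | zero => simp
  | add p q hp hq => simp only [map_add, Finsupp.add_apply, hp, hq]; ring
  | single l a =>
    simp only [awayRelations_single, Finsupp.sub_apply, Finsupp.single_apply, add_left_inj]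
    split_ifs <;> simp

theorem awayRelations_injective : Function.Injective (awayRelations z) := by
  rw [injective_iff_map_eq_zero]
  intro p hp
  ext k
  induction k with
  | zero => rw [← awayRelations_apply_zero z, hp]
  | succ k ih =>
    have := awayRelations_apply_succ z p k
    rw [hp, ih] at this
    simpa using this.symm

theorem awayGenerators_surjective : Function.Surjective (awayGenerators z) := by
  intro m
  induction m using LocalizedModule.induction_on with
  | _ a s =>
    obtain ⟨_, k, rfl⟩ := s
    exact ⟨Finsupp.single k a, awayGenerators_single z k a⟩

theorem single_sub_single_mem_range_awayRelations (k j : ℕ) (a : A) :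
    Finsupp.single k a - Finsupp.single (k + j) (z ^ j * a) ∈
      LinearMap.range (awayRelations z) := by
  induction j with
  | zero => simp
  | succ j ih =>
    rw [← sub_add_sub_cancel _ (Finsupp.single (k + j) (z ^ j * a))]
    refine add_mem ih ⟨Finsupp.single (k + j) (z ^ j * a), ?_⟩
    rw [awayRelations_single, ← mul_assoc, ← pow_succ', add_assoc]

/-- Bringing fractions to a common denominator: modulo the relations, `e_k = z ^ l e_{k+l}`. -/
theorem exists_sub_single_mem_range_awayRelations (p : ℕ →₀ A) :
    ∃ k a, p - Finsupp.single k a ∈ LinearMap.range (awayRelations z) := by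
  induction p using Finsupp.induction_linear with
  | zero => exact ⟨0, 0, by simp⟩
  | add p q hp hq =>
    obtain ⟨k, a, hk⟩ := hp
    obtain ⟨l, b, hl⟩ := hq
    refine ⟨k + l, z ^ l * a + z ^ k * b, ?_⟩
    have h₁ := add_mem hk (single_sub_single_mem_range_awayRelations z k l a)
    have h₂ := add_mem hl (single_sub_single_mem_range_awayRelations z l k b)
    rw [sub_add_sub_cancel] at h₁ h₂
    have h := add_mem h₁ h₂
    rw [add_comm l k] at h
    rwa [Finsupp.single_add, ← sub_add_sub_comm]
  | single k a => exact ⟨k, a, by simp⟩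

/-- A kernel element reduces to some `a e_k` with `z ^ j a = 0`, and `a e_k` is congruent to `z ^ j
a e_{k+j} = 0`. -/
theorem exact_awayRelations_awayGenerators :
    Function.Exact (awayRelations z) (awayGenerators z) := by
  rw [LinearMap.exact_iff]
  have hcomp : awayGenerators z ∘ₗ awayRelations z = 0 := by
    ext k
    simp only [LinearMap.comp_apply, Finsupp.lsingle_apply, awayRelations_single, map_sub,
      awayGenerators_single, LinearMap.zero_apply]
    rw [sub_eq_zero, LocalizedModule.mk_eq]
    exact ⟨1, by simp [Submonoid.smul_def, pow_succ]⟩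
  refine le_antisymm (fun p hp => ?_) (LinearMap.range_le_ker_iff.2 hcomp)
  obtain ⟨k, a, hk⟩ := exists_sub_single_mem_range_awayRelations z p
  have h0 : awayGenerators z (Finsupp.single k a) = 0 := by
    have := LinearMap.range_le_ker_iff.2 hcomp hk
    rw [LinearMap.mem_ker, map_sub, LinearMap.mem_ker.1 hp, zero_sub, neg_eq_zero] at this
    exact this
  rw [awayGenerators_single, ← LocalizedModule.zero_mk 1, LocalizedModule.mk_eq] at h0
  obtain ⟨⟨_, j, rfl⟩, hj⟩ := h0
  have hj' : z ^ j * a = 0 := by simpa [Submonoid.smul_def] using hj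
  have h1 := single_sub_single_mem_range_awayRelations z k j a
  rw [hj', Finsupp.single_zero, sub_zero] at h1
  simpa using add_mem hk h1

end Presentation

/-- A map from the free module to `M` is a sequence in `M`; precomposing with the relations turns it
into its telescope. -/
theorem extVanishes_localizedModule_powers_iff (z : A) :
    ExtVanishes (A := A) (LocalizedModule (Submonoid.powers z) A) M ↔ IsDerivedComplete z M := by
  have hS := ModuleCat.shortExact_of_linearMap (awayRelations_injective z)
    (exact_awayRelations_awayGenerators z) (awayGenerators_surjective z)
  have hP : Projective (ModuleCat.of A (ℕ →₀ A)) :=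
    (IsProjective.iff_projective (R := A) (ℕ →₀ A)).1 inferInstance
  have h := hS.forall_subsingleton_ext_iff_of_projective (ModuleCat.of A M)
  refine h.trans ?_
  let Φ : Ext.{u} (ModuleCat.of A (ℕ →₀ A)) (ModuleCat.of A M) 0 ≃ (ℕ → M) :=
    Ext.addEquiv₀.toEquiv.trans (ModuleCat.homEquiv.trans
      ((Finsupp.lift M A ℕ).symm.toEquiv))
  have hΦ : Φ ∘ (fun e => (Ext.mk₀ (ModuleCat.ofHom (awayRelations z))).comp e (zero_add 0)) =
      telescope z M ∘ Φ := by
    ext e k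
    obtain ⟨e, rfl⟩ := Ext.addEquiv₀.symm.surjective e
    have h₁ : ∀ e : ModuleCat.of A (ℕ →₀ A) ⟶ ModuleCat.of A M, ∀ k,
        Φ (Ext.addEquiv₀.symm e) k = e.hom (Finsupp.single k 1) := fun e k => by
      have h : Ext.addEquiv₀ (Ext.mk₀ e) = e := Ext.addEquiv₀.apply_symm_apply e
      simp [Φ, ModuleCat.homEquiv, h]
    have h₂ : (Ext.mk₀ (ModuleCat.ofHom (awayRelations z))).comp (Ext.addEquiv₀.symm e)
        (zero_add 0) = Ext.addEquiv₀.symm (ModuleCat.ofHom (awayRelations z) ≫ e) :=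
      Ext.mk₀_comp_mk₀ _ _
    simp only [Function.comp_apply, telescope_apply]
    rw [h₂, h₁, h₁, h₁]
    simp only [ModuleCat.hom_comp, ModuleCat.hom_ofHom, LinearMap.comp_apply,
      awayRelations_single, map_sub, mul_one]
    rw [← map_smul, Finsupp.smul_single, smul_eq_mul, mul_one]
  rw [IsDerivedComplete, ← Φ.bijective.of_comp_iff, ← hΦ]
  exact (Φ.comp_bijective _).symm

end ExtVanishes

/-- For a weakly regular sequence, the vanishing of all `Ext^q(x_i⁻¹A/(x_1, …, x_{i-1}), M)` means
that `M` is derived complete along every `x_i`. -/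
theorem forall_ext_localizedQuotient_subsingleton_iff {xs : List A}
    (hxs : RingTheory.Sequence.IsWeaklyRegular A xs) (M : Type u) [AddCommGroup M] [Module A M] :
    (∀ (i : Fin xs.length) (q : ℕ),
        Subsingleton (Abelian.Ext.{u} (ModuleCat.of A (localizedQuotient xs i))
          (ModuleCat.of A M) q)) ↔ ∀ x ∈ xs, IsDerivedComplete x M := by
  have key : ∀ i : Fin xs.length, (∀ y ∈ xs.take i, IsDerivedComplete y M) →
      (ExtVanishes (A := A) (localizedQuotient xs i) M ↔ IsDerivedComplete xs[i] M) := by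
    intro i hi
    have htake : RingTheory.Sequence.IsWeaklyRegular A (xs.take i) := by
      rw [← List.take_append_drop i xs, RingTheory.Sequence.isWeaklyRegular_append_iff] at hxs
      exact hxs.1
    rw [← extVanishes_localizedModule_powers_iff,
      ← extVanishes_localizedModule_quotient_iff _ hi htake]
    refine extVanishes_congr (LocalizedModule.congr _ (Submodule.quotEquivOfEq _ _ ?_))
    rw [smul_eq_mul, Ideal.mul_top]
  constructor
  · intro h
    -- `key` needs completeness along the earlier elements, hence strong induction.
    have : ∀ (i : ℕ) (hi : i < xs.length), IsDerivedComplete xs[i] M := by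
      intro i
      induction i using Nat.strong_induction_on with
      | _ i ih =>
        intro hi
        refine (key ⟨i, hi⟩ fun y hy => ?_).1 (h ⟨i, hi⟩)
        obtain ⟨j, hj, rfl⟩ := List.mem_take_iff_getElem.1 hy
        exact ih j (lt_min_iff.1 hj).1 _
    intro x hx
    obtain ⟨i, hi, rfl⟩ := List.mem_iff_getElem.1 hx
    exact this i hi
  · intro h i
    exact (key i fun y hy => h y (List.mem_of_mem_take hy)).2 (h _ (List.getElem_mem _))

/-! ### The map from `M` to the cokernel of completions -/

namespace AdicCompletion

variable {I : Ideal A} {M : Type*} [AddCommGroup M] [Module A M]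

/-- Lift the component of `c` in `M/IM`. For finitely generated `I`, the kernel of evaluation at
level 1 is `I` times the completion. -/
theorem exists_sub_of_mem_smul_top (hI : I.FG) (c : AdicCompletion I M) :
    ∃ m, c - of I M m ∈ (I • ⊤ : Submodule A (AdicCompletion I M)) := by
  obtain ⟨m, hm⟩ := Submodule.mkQ_surjective _ (c.val 1)
  refine ⟨m, ?_⟩
  have h : c - of I M m ∈ (I ^ 1 • ⊤ : Submodule A (AdicCompletion I M)) := by
    rw [pow_smul_top_eq_ker_eval hI, LinearMap.mem_ker, eval_apply, val_sub_apply, of_apply, ← hm,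
      sub_self]
  simpa using h

theorem mem_smul_top_of_of_mem {m : M}
    (h : of I M m ∈ (I • ⊤ : Submodule A (AdicCompletion I M))) :
    m ∈ (I • ⊤ : Submodule A M) := by
  have := pow_smul_top_le_ker_eval (I := I) (M := M) 1 (by simpa using h)
  rw [LinearMap.mem_ker, eval_of, Submodule.mkQ_apply, Submodule.Quotient.mk_eq_zero] at this
  simpa using this

end AdicCompletion

theorem Submodule.map_smul_top_le {M N : Type*} [AddCommGroup M] [Module A M] [AddCommGroup N]
    [Module A N] (I : Ideal A) (f : M →ₗ[A] N) :
    (I • ⊤ : Submodule A M).map f ≤ I • ⊤ := by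
  rw [Submodule.map_smul'']
  exact Submodule.smul_mono le_rfl le_top

/-- Vanishing of `Tor₁(A/(xs), M)` for `xs` weakly regular on `M`, in terms of a surjection onto
`M`. -/
theorem RingTheory.Sequence.IsWeaklyRegular.mem_smul_top_of_coe_mem {V M : Type*}
    [AddCommGroup V] [Module A V] [AddCommGroup M] [Module A M] {xs : List A}
    (h : IsWeaklyRegular M xs) {φ : V →ₗ[A] M} (hφ : Function.Surjective φ)
    {w : LinearMap.ker φ} (hw : (w : V) ∈ (Ideal.ofList xs • ⊤ : Submodule A V)) :
    w ∈ (Ideal.ofList xs • ⊤ : Submodule A (LinearMap.ker φ)) := by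
  have := map_first_exact_on_four_term_right_exact_of_isSMulRegular_last
    (f₁ := (0 : LinearMap.ker φ →ₗ[A] LinearMap.ker φ))
    ((LinearMap.exact_zero_iff_injective _ _).2 (Submodule.subtype_injective _))
    (LinearMap.exact_subtype_ker_map φ) hφ h
  obtain ⟨v, hv⟩ := (this (Submodule.Quotient.mk w)).1
    ((Submodule.Quotient.mk_eq_zero _).2 hw)
  obtain ⟨v, rfl⟩ := Submodule.mkQ_surjective _ v
  rw [← Submodule.Quotient.mk_eq_zero, ← hv]
  simp

section Comparison

variable {I : Ideal A} {xs : List A} {P₀ P₁ M L : Type u} [AddCommGroup P₀] [Module A P₀]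
  [AddCommGroup P₁] [Module A P₁] [AddCommGroup M] [Module A M] [AddCommGroup L] [Module A L]
  {d : P₁ →ₗ[A] P₀} {π : P₀ →ₗ[A] M} {e : AdicCompletion I P₀ →ₗ[A] L} {η : M →ₗ[A] L}

/-- If `P₁ → P₀ → M → 0` is exact, then the map from a derived complete module `M` to the cokernel
of `C^I(P₁) → C^I(P₀)` is surjective. -/
theorem IsDerivedComplete.surjective_to_cokernel (hI : I = Ideal.ofList xs)
    (he : Function.Surjective e)
    (hde : Function.Exact ((AdicCompletion.map I d).restrictScalars A) e)
    (hη : η ∘ₗ π = e ∘ₗ AdicCompletion.of I P₀) (hM : ∀ x ∈ xs, IsDerivedComplete x M) :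
    Function.Surjective η := by
  have hfg : I.FG := hI ▸ Submodule.fg_span (List.finite_toSet _)
  have hxI : ∀ x ∈ xs, x ∈ I := fun x hx => hI ▸ Ideal.subset_span hx
  have hQ : ∀ x ∈ xs, IsDerivedComplete x (L ⧸ LinearMap.range η) := fun x hx =>
    (hM x hx).quotient_range (.of_exact_surjective hde he (.adicCompletion (hxI x hx) _)
      (.adicCompletion (hxI x hx) _)) η
  rw [← LinearMap.range_eq_top, ← Submodule.Quotient.subsingleton_iff]
  refine IsDerivedComplete.subsingleton_of_ofList_smul_top xs hQ ?_
  rw [← hI, eq_top_iff]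
  rintro q -
  obtain ⟨l, rfl⟩ := Submodule.mkQ_surjective _ q
  obtain ⟨c, rfl⟩ := he l
  obtain ⟨p, hp⟩ := AdicCompletion.exists_sub_of_mem_smul_top hfg c
  have h0 : (LinearMap.range η).mkQ (e (AdicCompletion.of I P₀ p)) = 0 :=
    (Submodule.Quotient.mk_eq_zero _).2 ⟨π p, LinearMap.congr_fun hη p⟩
  have h1 := Submodule.map_smul_top_le I ((LinearMap.range η).mkQ ∘ₗ e)
    (Submodule.mem_map_of_mem hp)
  rwa [map_sub, LinearMap.comp_apply, LinearMap.comp_apply, h0, sub_zero] at h1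

/-- If `P₁ → P₀ → M → 0` is exact with a sequence generating `I` weakly regular on `P₀`, then the
map from a derived complete module `M` to the cokernel of `C^I(P₁) → C^I(P₀)` is injective. -/
theorem IsDerivedComplete.injective_to_cokernel (hI : I = Ideal.ofList xs)
    (hxs : RingTheory.Sequence.IsWeaklyRegular P₀ xs) (hπ : Function.Surjective π)
    (hdπ : π ∘ₗ d = 0) (he : Function.Surjective e)
    (hde : Function.Exact ((AdicCompletion.map I d).restrictScalars A) e)
    (hη : η ∘ₗ π = e ∘ₗ AdicCompletion.of I P₀) (hM : ∀ x ∈ xs, IsDerivedComplete x M) :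
    Function.Injective η := by
  have hfg : I.FG := hI ▸ Submodule.fg_span (List.finite_toSet _)
  have hxI : ∀ x ∈ xs, x ∈ I := fun x hx => hI ▸ Ideal.subset_span hx
  have hsurj := surjective_to_cokernel hI he hde hη hM
  have hη' : ∀ p, η (π p) = e (AdicCompletion.of I P₀ p) := LinearMap.congr_fun hη
  set D := (AdicCompletion.map I d).restrictScalars A with hD
  have hDof : ∀ p, D (AdicCompletion.of I P₁ p) = AdicCompletion.of I P₀ (d p) :=
    AdicCompletion.map_of I d
  have hK : ∀ x ∈ xs, IsDerivedComplete x (LinearMap.ker η) := fun x hx =>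
    (hM x hx).ker (.of_exact_surjective hde he (.adicCompletion (hxI x hx) _)
      (.adicCompletion (hxI x hx) _)) η
  -- The kernel of `φ` consists of pairs `(p, c)` with equal images in `C(P₀)`, and `p ↦ π p` sends
  -- it to `ker η`. Surjectivity of `φ` uses that of `η`.
  let φ : P₀ × AdicCompletion I P₁ →ₗ[A] AdicCompletion I P₀ :=
    (AdicCompletion.of I P₀).coprod (-D)
  have hφ : Function.Surjective φ := by
    intro c
    obtain ⟨m, hm⟩ := hsurj (e c)
    obtain ⟨p, rfl⟩ := hπ m
    obtain ⟨c', hc'⟩ := (hde (c - AdicCompletion.of I P₀ p)).1 (by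
      rw [map_sub, ← hη', hm, sub_self])
    exact ⟨(p, -c'), by simp [φ, hc']⟩
  let ψ : LinearMap.ker φ →ₗ[A] LinearMap.ker η :=
    LinearMap.codRestrict _ (π ∘ₗ LinearMap.fst A _ _ ∘ₗ (LinearMap.ker φ).subtype) (by
      rintro ⟨⟨p, c⟩, hpc⟩
      have hpc' : AdicCompletion.of I P₀ p = D c := by
        simpa [φ, ← sub_eq_add_neg, sub_eq_zero] using hpc
      change η (π p) = 0
      rw [hη', hpc', hde.apply_apply_eq_zero])
  rw [← LinearMap.ker_eq_bot, ← Submodule.subsingleton_iff_eq_bot]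
  refine IsDerivedComplete.subsingleton_of_ofList_smul_top xs hK (eq_top_iff.2 ?_)
  rintro ⟨k, hk⟩ -
  obtain ⟨p, rfl⟩ := hπ k
  obtain ⟨c, hc⟩ := (hde (AdicCompletion.of I P₀ p)).1 (by rw [← hη']; exact hk)
  -- Subtracting an element of `P₁` moves the pair `(p, c)` into `I (P₀ × C(P₁))` without changing
  -- `π p`.
  obtain ⟨q, hq⟩ := AdicCompletion.exists_sub_of_mem_smul_top hfg c
  set c' := c - AdicCompletion.of I P₁ q with hc'
  have hof : AdicCompletion.of I P₀ (p - d q) = D c' := by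
    rw [hc', map_sub, map_sub, hc, hDof]
  have hp : p - d q ∈ (I • ⊤ : Submodule A P₀) := by
    refine AdicCompletion.mem_smul_top_of_of_mem ?_
    rw [hof]
    exact Submodule.map_smul_top_le I D (Submodule.mem_map_of_mem hq)
  let w : LinearMap.ker φ := ⟨(p - d q, c'), by simp [φ, hof]⟩
  have hw : (w : P₀ × AdicCompletion I P₁) ∈ (Ideal.ofList xs • ⊤ : Submodule A _) := by
    have : (w : P₀ × AdicCompletion I P₁) =
        LinearMap.inl A _ _ (p - d q) + LinearMap.inr A _ _ c' := by simp [w]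
    rw [this, ← hI]
    exact add_mem (Submodule.map_smul_top_le I _ (Submodule.mem_map_of_mem hp))
      (Submodule.map_smul_top_le I _ (Submodule.mem_map_of_mem hq))
  -- Regularity on `C(P₀)` puts `w` in `I (ker φ)`, so its image `π p` lies in `I (ker η)`.
  have hC := hxs.adicCompletion (I := I) (by rw [hI])
  have hmem := Submodule.map_smul_top_le _ ψ
    (Submodule.mem_map_of_mem (hC.mem_smul_top_of_coe_mem hφ hw))
  convert hmem using 1
  refine Subtype.ext ?_
  change π p = π (p - d q)
  rw [map_sub, ← LinearMap.comp_apply, hdπ, LinearMap.zero_apply, sub_zero]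

end Comparison

/-! ### The zeroth left derived functor as a cokernel -/

section ZerothDerivedFunctor

open Limits HomologicalComplex

variable {C D : Type*} [Category* C] [Abelian C] [HasProjectiveResolutions C] [Category* D]
  [Abelian D]

namespace CategoryTheory.ProjectiveResolution

variable {X : C} (P : ProjectiveResolution X) (F : C ⥤ D) [F.Additive]

/-- The zeroth left derived functor as the homology of `F(P)`. -/
def homologyIsoLeftDerivedZero :
    ((F.mapHomologicalComplex (ComplexShape.down ℕ)).obj P.complex).homology 0 ≅
      (F.leftDerived 0).obj X :=
  (P.isoLeftDerivedObj F 0).symm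

/-- The zeroth left derived functor is the cokernel of `F(P₁) → F(P₀)`. -/
def opcyclesIsoLeftDerivedZero :
    ((F.mapHomologicalComplex (ComplexShape.down ℕ)).obj P.complex).opcycles 0 ≅
      (F.leftDerived 0).obj X :=
  (ChainComplex.isoHomologyι₀ _).symm ≪≫ P.homologyIsoLeftDerivedZero F

/-- The projection of `F(P₀)` onto the zeroth left derived functor of `F`. -/
def toLeftDerivedZero :
    ((F.mapHomologicalComplex (ComplexShape.down ℕ)).obj P.complex).X 0 ⟶ (F.leftDerived 0).obj X :=
  ((F.mapHomologicalComplex _).obj P.complex).pOpcycles 0 ≫ (P.opcyclesIsoLeftDerivedZero F).hom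

instance : Epi (P.toLeftDerivedZero F) := by
  unfold toLeftDerivedZero
  infer_instance

theorem d_comp_toLeftDerivedZero :
    ((F.mapHomologicalComplex (ComplexShape.down ℕ)).obj P.complex).d 1 0 ≫
      P.toLeftDerivedZero F = 0 := by
  rw [toLeftDerivedZero, d_pOpcycles_assoc, zero_comp]

theorem exact_toLeftDerivedZero :
    (ShortComplex.mk _ _ (P.d_comp_toLeftDerivedZero F)).Exact := by
  let K := (F.mapHomologicalComplex (ComplexShape.down ℕ)).obj P.complex
  have h : (ShortComplex.mk (K.d 1 0) (K.pOpcycles 0) (K.d_pOpcycles 1 0)).Exact :=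
    ShortComplex.exact_of_g_is_cokernel _ (K.opcyclesIsCokernel 1 0 (by simp))
  let i : ShortComplex.mk (K.d 1 0) (K.pOpcycles 0) (K.d_pOpcycles 1 0) ≅
      ShortComplex.mk _ _ (P.d_comp_toLeftDerivedZero F) :=
    ShortComplex.isoMk (Iso.refl (K.X 1)) (Iso.refl (K.X 0)) (P.opcyclesIsoLeftDerivedZero F)
      ((Category.id_comp _).trans (Category.comp_id _).symm) (Category.id_comp _)
  exact ShortComplex.exact_of_iso i h

/-- Used for the identity functor, where it recovers the augmentation `P₀ → X` and so makes `η`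
computable. -/
theorem toLeftDerivedZero_comp_fromLeftDerivedZero :
    P.toLeftDerivedZero F ≫ F.fromLeftDerivedZero.app X = F.map (P.π.f 0) := by
  have h : (P.opcyclesIsoLeftDerivedZero F).hom ≫ F.fromLeftDerivedZero.app X =
      P.fromLeftDerivedZero' F := by
    rw [P.fromLeftDerivedZero_eq]
    change ((ChainComplex.isoHomologyι₀ _).inv ≫ (P.homologyIsoLeftDerivedZero F).hom) ≫
      (P.homologyIsoLeftDerivedZero F).inv ≫ (ChainComplex.isoHomologyι₀ _).hom ≫ _ = _
    rw [Category.assoc, Iso.hom_inv_id_assoc, Iso.inv_hom_id_assoc]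
  rw [toLeftDerivedZero, Category.assoc, h]
  exact P.pOpcycles_comp_fromLeftDerivedZero' F

theorem toLeftDerivedZero_naturality {F G : C ⥤ D} [F.Additive] [G.Additive] (α : F ⟶ G) :
    ((NatTrans.mapHomologicalComplex α _).app P.complex).f 0 ≫ P.toLeftDerivedZero G =
      P.toLeftDerivedZero F ≫ (NatTrans.leftDerived α 0).app X := by
  rw [P.leftDerived_app_eq, toLeftDerivedZero, toLeftDerivedZero,
    ← HomologicalComplex.p_opcyclesMap_assoc, Category.assoc]
  congr 1
  change _ ≫ (ChainComplex.isoHomologyι₀ _).inv ≫ (P.homologyIsoLeftDerivedZero G).hom =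
    ((ChainComplex.isoHomologyι₀ _).inv ≫ (P.homologyIsoLeftDerivedZero F).hom) ≫
      (P.homologyIsoLeftDerivedZero F).inv ≫ homologyMap _ 0 ≫
        (P.homologyIsoLeftDerivedZero G).hom
  rw [Category.assoc, Iso.hom_inv_id_assoc, ChainComplex.isoHomologyι₀_inv_naturality_assoc]

end CategoryTheory.ProjectiveResolution

end ZerothDerivedFunctor

/-- The map `η : M → L_0 M` computed on a projective resolution `P` of `M`. -/
theorem toDerivedCompletion_app_resolution (I : Ideal A) {M : ModuleCat.{u} A}
    (P : ProjectiveResolution M) (p : P.complex.X 0) :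
    ((toDerivedCompletion I).app M).hom ((P.π.f 0).hom p) =
      (P.toLeftDerivedZero (adicCompletionFunctor I)).hom (AdicCompletion.of I _ p) := by
  have h₁ := P.toLeftDerivedZero_naturality (toAdicCompletion I)
  have h₂ := P.toLeftDerivedZero_comp_fromLeftDerivedZero (𝟭 _)
  have h₃ := (𝟭 (ModuleCat.{u} A)).leftDerivedZeroIsoSelf_hom_inv_id_app M
  have h₁' := ConcreteCategory.congr_hom h₁ p
  have h₂' : ((𝟭 (ModuleCat.{u} A)).fromLeftDerivedZero.app M).hom
    ((P.toLeftDerivedZero (𝟭 _)).hom p) = (P.π.f 0).hom p := ConcreteCategory.congr_hom h₂ p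
  have h₃' := ConcreteCategory.congr_hom h₃ ((P.toLeftDerivedZero (𝟭 _)).hom p)
  rw [← h₂']
  refine Eq.trans ?_ h₁'.symm
  change ((NatTrans.leftDerived (toAdicCompletion I) 0).app M).hom
    (((𝟭 (ModuleCat.{u} A)).leftDerivedZeroIsoSelf.inv.app M).hom _) =
    ((NatTrans.leftDerived (toAdicCompletion I) 0).app M).hom _
  exact congrArg _ h₃'

/-! ### `L`-completeness as derived completeness -/

/-- A module is `L`-complete with respect to an ideal generated by a weakly regular sequence if and
only if it is derived complete along each element of the sequence. -/
theorem isLComplete_iff_forall_isDerivedComplete {I : Ideal A} {xs : List A}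
    (hxs : RingTheory.Sequence.IsWeaklyRegular A xs) (hI : I = Ideal.ofList xs)
    (M : Type u) [AddCommGroup M] [Module A M] :
    IsLComplete I M ↔ ∀ x ∈ xs, IsDerivedComplete x M := by
  have hxI : ∀ x ∈ xs, x ∈ I := fun x hx => hI ▸ Ideal.subset_span hx
  let P := projectiveResolution (ModuleCat.of A M)
  let d : P.complex.X 1 →ₗ[A] P.complex.X 0 := (P.complex.d 1 0).hom
  let π : P.complex.X 0 →ₗ[A] M := (P.π.f 0).hom
  let e : AdicCompletion I (P.complex.X 0) →ₗ[A] (derivedCompletion I 0).obj (ModuleCat.of A M) :=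
    (P.toLeftDerivedZero (adicCompletionFunctor I)).hom
  let η : M →ₗ[A] (derivedCompletion I 0).obj (ModuleCat.of A M) :=
    ((toDerivedCompletion I).app (ModuleCat.of A M)).hom
  have he : Function.Surjective e := (ModuleCat.epi_iff_surjective
    (P.toLeftDerivedZero (adicCompletionFunctor I))).1 inferInstance
  have hde : Function.Exact ((AdicCompletion.map I d).restrictScalars A) e :=
    (ShortComplex.ShortExact.moduleCat_exact_iff_function_exact _).1
      (P.exact_toLeftDerivedZero (adicCompletionFunctor I))
  have hη : η ∘ₗ π = e ∘ₗ AdicCompletion.of I _ :=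
    LinearMap.ext fun p => toDerivedCompletion_app_resolution I P p
  have hπ : Function.Surjective π := (ModuleCat.epi_iff_surjective (P.π.f 0)).1 inferInstance
  have hdπ : π ∘ₗ d = 0 := congrArg ModuleCat.Hom.hom P.complex_d_comp_π_f_zero
  have hbij : IsLComplete I M ↔ Function.Bijective η :=
    ConcreteCategory.isIso_iff_bijective ((toDerivedCompletion I).app (ModuleCat.of A M))
  rw [hbij]
  constructor
  · intro h x hx
    exact (IsDerivedComplete.of_exact_surjective hde he (.adicCompletion (hxI x hx) _)
      (.adicCompletion (hxI x hx) _)).of_equiv (LinearEquiv.ofBijective η h).symm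
  · intro h
    have : Module.Projective A (P.complex.X 0) :=
      (IsProjective.iff_projective (R := A) _).2 (P.projective 0)
    -- Projective modules are flat, so regularity passes from `A` to `A ⊗ P₀ ≅ P₀`.
    have hP : RingTheory.Sequence.IsWeaklyRegular (P.complex.X 0) xs :=
      (TensorProduct.lid A (P.complex.X 0)).isWeaklyRegular_congr xs |>.1
        hxs.isWeaklyRegular_rTensor
    exact ⟨IsDerivedComplete.injective_to_cokernel hI hP hπ hdπ he hde hη h,
      IsDerivedComplete.surjective_to_cokernel hI he hde hη h⟩

end

theorem theoremB {A : Type u} [CommRing A] (I : Ideal A) (xs : List A)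
    (hxs : RingTheory.Sequence.IsWeaklyRegular A xs) (hI : I = Ideal.ofList xs)
    (M : Type u) [AddCommGroup M] [Module A M] :
    IsLComplete I M ↔
      ∀ (i : Fin xs.length) (q : ℕ),
        Subsingleton (Abelian.Ext.{u} (ModuleCat.of A (localizedQuotient xs i))
          (ModuleCat.of A M) q) :=
  (isLComplete_iff_forall_isDerivedComplete hxs hI M).trans
    (forall_ext_localizedQuotient_subsingleton_iff hxs M).symm
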